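/- Define $k$-trees recursively ($k\ge 1$): a clique on $k$ vertices is a $k$-tree, and if a graph $G$ has a vertex $v$ of degree $k$ whose neighbourhood is a clique and $G\setminus v$ is a $k$-tree, then $G$ is a $k$-tree. A partial $2$-tree is any subgraph of a $2$-tree (it need not be connected). There is a function $\varepsilon:\mathbb{N}\to\mathbb{R}$ with $\varepsilon(n)\to 0$ as $n\to\infty$ such that, for every positive integer $n$, every partial $2$-tree that contains a path on $n$ vertices (as a not necessarily induced subgraph) contains an induced path on at least $\left(\tfrac12-\varepsilon(n)\right)\log_2 n$ vertices. -/

import Mathlib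

universe u

/-- A vertex `v` of `G` is `k`-simplicial if its neighbourhood is a clique and it has degree `k`. -/
def IsKSimplicial {V : Type u} (G : SimpleGraph V) (k : ℕ) (v : V) : Prop :=
  G.IsClique (G.neighborSet v) ∧ (G.neighborSet v).Finite ∧ (G.neighborSet v).ncard = k

/-- The class of `k`-trees, defined recursively: a clique on `k` vertices is a `k`-tree, and if
`v` is a `k`-simplicial vertex of `G` and `G ∖ v` is a `k`-tree, then `G` is a `k`-tree. -/
inductive IsKTree (k : ℕ) : ∀ {V : Type u}, SimpleGraph V → Prop
  | clique {V : Type u} (G : SimpleGraph V) (hfin : Finite V) (hcard : Nat.card V = k)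
      (hclique : G = ⊤) : IsKTree k G
  | add {V : Type u} (G : SimpleGraph V) (v : V) (hv : IsKSimplicial G k v)
      (hG : IsKTree k (G.induce {w : V | w ≠ v})) : IsKTree k G

/-- A partial `k`-tree is a graph that is (isomorphic to) a subgraph, not necessarily spanning or
induced, of a `k`-tree. -/
def IsPartialKTree (k : ℕ) {V : Type u} (G : SimpleGraph V) : Prop :=
  ∃ (W : Type u) (H : SimpleGraph W), IsKTree k H ∧ G.IsContained H

open SimpleGraph

/-! Number the path `0, …, n - 1` and fix a threshold `M ≈ n / log₂ n`. If every edge of `G` between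
path vertices spans at most `M`, jumping each time to the furthest neighbour gives an induced path
on about `n / M` vertices (`IsInducedPath.exists_extend`). Otherwise some edge `ab` spans more than
`M` and closes a segment of the path into a cycle. Two crossing chords of it would give a `K₄`
minor, impossible in a 2-tree (`IsKTree.not_adj_of_crossing`). Without crossings, repeated halving
of the segment yields induced paths from `a` and from `b` of total length at least `log₂ M`
(`exists_isInducedPath_pair`); the longer one has at least half of it. -/

/-! ### Complete minors in `k`-trees and crossing chords -/

/-- A set of vertices is connected in the sense of cuts: it is nonempty and every proper nonempty
part of it sends an edge to the rest. -/
def CutConnected {V : Type u} (G : SimpleGraph V) (S : Set V) : Prop :=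
  S.Nonempty ∧ ∀ A ⊆ S, A.Nonempty → (S \ A).Nonempty → ∃ x ∈ A, ∃ y ∈ S \ A, G.Adj x y

/-- `B` is a family of disjoint connected vertex sets, any two of which are joined by an edge: a
model of a complete minor on `Fin r`. -/
structure IsCompleteModel {V : Type u} (G : SimpleGraph V) {r : ℕ} (B : Fin r → Set V) :
    Prop where
  connected : ∀ i, CutConnected G (B i)
  disjoint : ∀ i j, i ≠ j → Disjoint (B i) (B j)
  adj : ∀ i j, i ≠ j → ∃ x ∈ B i, ∃ y ∈ B j, G.Adj x y

/-- Any passage through `v` can be shortcut, because two neighbours of `v` are equal or adjacent. -/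
lemma CutConnected.preimage_ne {V : Type u} {G : SimpleGraph V} {S : Set V} {v : V}
    (hS : CutConnected G S) (hv : G.IsClique (G.neighborSet v)) (hne : ∃ x ∈ S, x ≠ v) :
    CutConnected (G.induce {w : V | w ≠ v}) (Subtype.val ⁻¹' S) := by
  obtain ⟨x₀, hx₀, hx₀v⟩ := hne
  refine ⟨⟨⟨x₀, hx₀v⟩, hx₀⟩, fun A hA hAn hAc => ?_⟩
  obtain ⟨⟨a, ha⟩, haA⟩ := hAn
  obtain ⟨⟨b, hb⟩, hbS, hbA⟩ := hAc
  have hAS : Subtype.val '' A ⊆ S := by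
    rintro _ ⟨x, hx, rfl⟩
    exact hA hx
  obtain ⟨_, ⟨⟨x, hxv⟩, hxA, rfl⟩, y, ⟨hyS, hyA⟩, hxy⟩ := hS.2 (Subtype.val '' A) hAS
    ⟨a, ⟨a, ha⟩, haA, rfl⟩ ⟨b, hbS, by rintro ⟨z, hz, rfl⟩; exact hbA hz⟩
  by_cases hyv : y = v
  · rw [hyv] at hxy hyS
    have hvS : insert v (Subtype.val '' A) ⊆ S := Set.insert_subset hyS hAS
    obtain ⟨x', hx', z, ⟨hzS, hzA⟩, hxz⟩ := hS.2 _ hvS ⟨v, Set.mem_insert _ _⟩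
      ⟨b, hbS, by
        rintro (h | ⟨z, hz, h⟩)
        · exact hb h
        · exact hbA (by subst h; exact hz)⟩
    have hzv : z ≠ v := fun h => hzA (Or.inl h)
    have hzA' : (⟨z, hzv⟩ : {w : V | w ≠ v}) ∉ A := fun h => hzA (Or.inr ⟨_, h, rfl⟩)
    rcases hx' with hx' | ⟨⟨x'', hx''⟩, hx'A, hx'⟩
    · rw [hx'] at hxz
      refine ⟨⟨x, hxv⟩, hxA, ⟨z, hzv⟩, ⟨hzS, hzA'⟩, ?_⟩
      exact hv hxy.symm hxz fun h => hzA' (by subst h; exact hxA)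
    · rw [← hx'] at hxz
      exact ⟨⟨x'', hx''⟩, hx'A, ⟨z, hzv⟩, ⟨hzS, hzA'⟩, hxz⟩
  · exact ⟨⟨x, hxv⟩, hxA, ⟨y, hyv⟩, ⟨hyS, fun h => hyA ⟨_, h, rfl⟩⟩, hxy⟩

/-- A branch set equal to `{v}` would force neighbours of `v` in the `k + 1` other, disjoint branch
sets, but `v` has degree `k`. -/
lemma IsCompleteModel.exists_ne_of_isKSimplicial {V : Type u} {G : SimpleGraph V} {k : ℕ}
    {B : Fin (k + 2) → Set V} (hB : IsCompleteModel G B) {v : V} (hv : IsKSimplicial G k v)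
    (i : Fin (k + 2)) : ∃ x ∈ B i, x ≠ v := by
  by_contra! h
  have key : ∀ j : {j : Fin (k + 2) // j ≠ i}, ∃ y ∈ B j, G.Adj v y := by
    rintro ⟨j, hj⟩
    obtain ⟨x, hx, y, hy, hxy⟩ := hB.adj i j hj.symm
    exact ⟨y, hy, h x hx ▸ hxy⟩
  choose f hf hfv using key
  have hinj : Function.Injective fun j => (⟨f j, hfv j⟩ : G.neighborSet v) := by
    intro j j' hjj
    by_contra hne
    have h1 : f j = f j' := congrArg Subtype.val hjj
    exact Set.disjoint_left.1 (hB.disjoint j j' fun e => hne (Subtype.ext e)) (hf j)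
      (h1 ▸ hf j')
  have := hv.2.1.to_subtype
  have hle := Nat.card_le_card_of_injective _ hinj
  have hcard : Nat.card {j : Fin (k + 2) // j ≠ i} = k + 1 := by
    simp [Nat.card_eq_fintype_card, Fintype.card_subtype_compl]
  rw [hcard, Nat.card_coe_set_eq, hv.2.2] at hle
  omega

lemma IsCompleteModel.preimage_ne {V : Type u} {G : SimpleGraph V} {k : ℕ}
    {B : Fin (k + 2) → Set V} (hB : IsCompleteModel G B) {v : V} (hv : IsKSimplicial G k v) :
    IsCompleteModel (G.induce {w : V | w ≠ v})
      fun i => (Subtype.val ⁻¹' B i : Set {w : V | w ≠ v}) := by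
  have hne := hB.exists_ne_of_isKSimplicial hv
  -- An edge leaving `B i` at `v` can be moved to a neighbour of `v` inside `B i`, as the
  -- neighbourhood is a clique.
  have key : ∀ i j, i ≠ j → v ∈ B i → ∀ y ∈ B j, G.Adj v y →
      ∃ x ∈ B i, x ≠ v ∧ G.Adj x y := by
    intro i j hij hvi y hy hvy
    obtain ⟨x₀, hx₀, hx₀v⟩ := hne i
    obtain ⟨_, rfl, x, ⟨hxB, hxv⟩, hvx⟩ := (hB.connected i).2 {v} (by simpa using hvi)
      ⟨v, rfl⟩ ⟨x₀, hx₀, hx₀v⟩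
    exact ⟨x, hxB, hxv, hv.1 hvx hvy fun h =>
      Set.disjoint_left.1 (hB.disjoint i j hij) hxB (h ▸ hy)⟩
  refine ⟨fun i => (hB.connected i).preimage_ne hv.1 (hne i),
    fun i j hij => (hB.disjoint i j hij).preimage _, fun i j hij => ?_⟩
  obtain ⟨x, hx, y, hy, hxy⟩ := hB.adj i j hij
  by_cases hxv : x = v
  · subst hxv
    obtain ⟨x', hx', hx'v, hx'y⟩ := key i j hij hx y hy hxy
    exact ⟨⟨x', hx'v⟩, hx', ⟨y, hxy.ne'⟩, hy, hx'y⟩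
  by_cases hyv : y = v
  · subst hyv
    obtain ⟨y', hy', hy'v, hy'x⟩ := key j i hij.symm hy x hx hxy.symm
    exact ⟨⟨x, hxv⟩, hx, ⟨y', hy'v⟩, hy', hy'x.symm⟩
  exact ⟨⟨x, hxv⟩, hx, ⟨y, hyv⟩, hy, hxy⟩

/-- A `k`-tree has no complete minor on `k + 2` vertices. -/
lemma IsKTree.not_isCompleteModel {k : ℕ} {V : Type u} {G : SimpleGraph V} (hG : IsKTree k G)
    (B : Fin (k + 2) → Set V) : ¬ IsCompleteModel G B := by
  induction hG with
  | clique G hfin hcard _ =>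
    intro hB
    choose f hf using fun i => (hB.connected i).1
    have hinj : Function.Injective f := by
      intro i j hij
      by_contra hne
      exact Set.disjoint_left.1 (hB.disjoint i j hne) (hf i) (hij ▸ hf j)
    have := Nat.card_le_card_of_injective f hinj
    simp only [Nat.card_eq_fintype_card, Fintype.card_fin] at this
    rw [hcard] at this
    omega
  | add G v hv _ ih => exact fun hB => ih _ (hB.preimage_ne hv)

lemma cutConnected_image_Icc {V : Type u} {G : SimpleGraph V} {c : ℕ → V} {a b : ℕ}
    (hab : a ≤ b) (hc : ∀ x, a ≤ x → x < b → G.Adj (c x) (c (x + 1))) :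
    CutConnected G (c '' Set.Icc a b) := by
  refine ⟨⟨c a, a, ⟨le_rfl, hab⟩, rfl⟩, fun A hA hAn hAc => ?_⟩
  by_contra! h
  have mem : ∀ x, a ≤ x → x ≤ b → c x ∈ c '' Set.Icc a b := fun x h1 h2 => ⟨x, ⟨h1, h2⟩, rfl⟩
  have key : ∀ x, a ≤ x → x ≤ b → (c x ∈ A ↔ c a ∈ A) := by
    intro x hax
    induction x, hax using Nat.le_induction with
    | base => exact fun _ => Iff.rfl
    | succ x hax ih =>
      intro hxb
      rw [← ih (by omega)]
      have hadj := hc x hax (by omega)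
      constructor
      · intro h1
        by_contra h2
        exact h _ h1 _ ⟨mem x hax (by omega), h2⟩ hadj.symm
      · intro h1
        by_contra h2
        exact h _ h1 _ ⟨mem (x + 1) (by omega) hxb, h2⟩ hadj
  obtain ⟨p, hp⟩ := hAn
  obtain ⟨x, hx, rfl⟩ := hA hp
  obtain ⟨_, ⟨y, hy, rfl⟩, hyA⟩ := hAc
  exact hyA ((key y hy.1 hy.2).2 ((key x hx.1 hx.2).1 hp))

/-- A cycle of a `2`-tree has no two crossing chords. -/
lemma IsKTree.not_adj_of_crossing {V : Type u} {G : SimpleGraph V} (hG : IsKTree 2 G)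
    {c : ℕ → V} {a b : ℕ} (hinj : Set.InjOn c (Set.Icc a b))
    (hc : ∀ x, a ≤ x → x < b → G.Adj (c x) (c (x + 1))) (hab : G.Adj (c a) (c b))
    {i j k l : ℕ} (hai : a ≤ i) (hij : i < j) (hjk : j < k) (hkl : k < l) (hlb : l ≤ b)
    (hik : G.Adj (c i) (c k)) : ¬ G.Adj (c j) (c l) := by
  intro hjl
  have hconn : ∀ x y, a ≤ x → x ≤ y → y ≤ b → CutConnected G (c '' Set.Icc x y) :=
    fun x y h1 h2 h3 => cutConnected_image_Icc h2 fun z h4 h5 => hc z (by omega) (by omega)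
  have hdisj : ∀ x y x' y', a ≤ x → y < x' → y' ≤ b →
      Disjoint (c '' Set.Icc x y) (c '' Set.Icc x' y') := by
    intro x y x' y' h1 h2 h3
    rw [Set.disjoint_left]
    rintro _ ⟨p, hp, rfl⟩ ⟨q, hq, hpq⟩
    simp only [Set.mem_Icc] at hp hq
    have := hinj (by simp only [Set.mem_Icc]; omega) (by simp only [Set.mem_Icc]; omega) hpq
    omega
  have hadj : ∀ {x y x' y'} p q, x ≤ p → p ≤ y → x' ≤ q → q ≤ y' → G.Adj (c p) (c q) →
      ∃ s ∈ c '' Set.Icc x y, ∃ t ∈ c '' Set.Icc x' y', G.Adj s t :=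
    fun p q h1 h2 h3 h4 h => ⟨c p, ⟨p, ⟨h1, h2⟩, rfl⟩, c q, ⟨q, ⟨h3, h4⟩, rfl⟩, h⟩
  have hstep : ∀ x, a < x → x ≤ b → G.Adj (c (x - 1)) (c x) := by
    intro x h1 h2
    have := hc (x - 1) (by omega) (by omega)
    rwa [Nat.sub_add_cancel (by omega)] at this
  -- Cutting the cycle just before `j`, `k` and `l` gives four arcs: path edges and `ab` join
  -- cyclically consecutive arcs, the two crossing chords join opposite ones.
  let B : Fin 4 → Set V := ![c '' Set.Icc a (j - 1), c '' Set.Icc j (k - 1),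
    c '' Set.Icc k (l - 1), c '' Set.Icc l b]
  have hd : ∀ p q : Fin 4, p < q → Disjoint (B p) (B q) := by
    intro p q hpq
    fin_cases p <;> fin_cases q <;> first
      | exact absurd hpq (by decide)
      | exact hdisj _ _ _ _ (by omega) (by omega) (by omega)
  have ha : ∀ p q : Fin 4, p < q → ∃ x ∈ B p, ∃ y ∈ B q, G.Adj x y := by
    intro p q hpq
    fin_cases p <;> fin_cases q <;> first
      | exact absurd hpq (by decide)
      | skip
    · exact hadj (j - 1) j (by omega) (by omega) (by omega) (by omega)
        (hstep j (by omega) (by omega))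
    · exact hadj i k (by omega) (by omega) (by omega) (by omega) hik
    · exact hadj a b (by omega) (by omega) (by omega) (by omega) hab
    · exact hadj (k - 1) k (by omega) (by omega) (by omega) (by omega)
        (hstep k (by omega) (by omega))
    · exact hadj j l (by omega) (by omega) (by omega) (by omega) hjl
    · exact hadj (l - 1) l (by omega) (by omega) (by omega) (by omega)
        (hstep l (by omega) (by omega))
  refine hG.not_isCompleteModel B ⟨fun p => ?_, fun p q hpq => ?_, fun p q hpq => ?_⟩
  · fin_cases p <;> exact hconn _ _ (by omega) (by omega) (by omega)
  · rcases lt_or_gt_of_ne hpq with h | h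
    exacts [hd p q h, (hd q p h).symm]
  · rcases lt_or_gt_of_ne hpq with h | h
    · exact ha p q h
    · obtain ⟨x, hx, y, hy, hxy⟩ := ha q p h
      exact ⟨y, hy, x, hx, hxy.symm⟩

/-! ### Induced paths as lists -/

/-- The list enumerates the vertices of an induced path in order. -/
def IsInducedPath {V : Type u} (G : SimpleGraph V) : List V → Prop
  | [] => True
  | [_] => True
  | a :: b :: l => G.Adj a b ∧ (∀ x ∈ l, x ≠ a ∧ ¬ G.Adj x a) ∧ IsInducedPath G (b :: l)

lemma IsInducedPath.getElem {V : Type u} {G : SimpleGraph V} :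
    ∀ {l : List V}, IsInducedPath G l → ∀ (i j : ℕ) (hi : i < l.length) (hj : j < l.length),
      i < j → l[i] ≠ l[j] ∧ (G.Adj l[i] l[j] ↔ i + 1 = j)
  | [], _, i, _, hi, _, _ => by simp at hi
  | [_], _, i, j, hi, hj, hij => by simp at hi hj; omega
  | a :: b :: l, h, i, j, hi, hj, hij => by
    obtain ⟨hab, hl, hbl⟩ := h
    obtain ⟨j, rfl⟩ : ∃ j', j = j' + 1 := ⟨j - 1, by omega⟩
    rcases i with _ | i
    · rcases j with _ | j
      · simpa using ⟨hab.ne, hab⟩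
      · have hj' : j < l.length := by simpa using hj
        have := hl l[j] (List.getElem_mem _)
        simpa using ⟨this.1.symm, fun h => this.2 h.symm⟩
    · have := hbl.getElem i j (by simpa using hi) (by simpa using hj) (by omega)
      simpa using this

lemma IsInducedPath.isIndContained {V : Type u} {G : SimpleGraph V} {c : ℕ → V} {l : List ℕ}
    (h : IsInducedPath (G.comap c) l) (hinj : Set.InjOn c {x | x ∈ l}) :
    (pathGraph l.length).IsIndContained G := by
  have hne : ∀ i j : Fin l.length, i ≠ j → l[i] ≠ l[j] := by
    intro i j hij
    rcases lt_or_gt_of_ne hij with h1 | h1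
    · exact (h.getElem i j i.2 j.2 h1).1
    · exact (h.getElem j i j.2 i.2 h1).1.symm
  refine ⟨⟨⟨fun i => c l[i], fun i j hij => ?_⟩, fun {i j} => ?_⟩⟩
  · by_contra h1
    exact hne i j h1 (hinj (List.getElem_mem _) (List.getElem_mem _) hij)
  · change G.Adj (c l[(i : ℕ)]) (c l[(j : ℕ)]) ↔ _
    rw [pathGraph_adj]
    rcases lt_trichotomy i j with h1 | rfl | h1
    · have := (h.getElem i j i.2 j.2 h1).2
      simp only [comap_adj] at this
      have h2 : (i : ℕ) < j := h1
      rw [this]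
      omega
    · simp
    · have := (h.getElem j i j.2 i.2 h1).2
      simp only [comap_adj] at this
      have h2 : (j : ℕ) < i := h1
      rw [adj_comm, this]
      omega

/-! ### Greedy and halving constructions -/

lemma exists_greatest_adj {G : SimpleGraph ℕ} {u v : ℕ} (huv : u + 1 ≤ v)
    (h : G.Adj u (u + 1)) :
    ∃ w, u < w ∧ w ≤ v ∧ G.Adj u w ∧ ∀ x, w < x → x ≤ v → ¬ G.Adj u x := by
  classical
  refine ⟨Nat.findGreatest (G.Adj u) v, ?_, Nat.findGreatest_le v,
    Nat.findGreatest_spec (P := G.Adj u) huv h, fun x => Nat.findGreatest_is_greatest⟩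
  exact Nat.lt_of_succ_le (Nat.le_findGreatest huv h)

/-- An induced path ending at `w` can be continued greedily up to `v`, in steps of size at
most `M`. -/
lemma IsInducedPath.exists_extend {G : SimpleGraph ℕ} {v M : ℕ} :
    ∀ (d w : ℕ) (l : List ℕ), v = w + d →
      (∀ x, w ≤ x → x < v → G.Adj x (x + 1)) →
      (∀ x y, w ≤ x → x < y → y ≤ v → G.Adj x y → y ≤ x + M) →
      IsInducedPath G (w :: l) → (∀ x ∈ l, x < w) →
      (∀ x ∈ l, ∀ y, w < y → y ≤ v → ¬ G.Adj x y) →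
      ∃ l', IsInducedPath G (v :: l') ∧ (∀ x ∈ l', x ∈ l ∨ w ≤ x ∧ x < v) ∧
        v + M * l.length ≤ w + M * l'.length := by
  intro d
  induction d using Nat.strong_induction_on with
  | _ d ih =>
    intro w l hv hpath hM hl hlt hadj
    rcases Nat.eq_zero_or_pos d with rfl | hd
    · obtain rfl : v = w := by omega
      exact ⟨l, hl, fun x hx => Or.inl hx, le_rfl⟩
    obtain ⟨g, hwg, hgv, hwadj, hmax⟩ :=
      exists_greatest_adj (by omega : w + 1 ≤ v) (hpath w le_rfl (by omega))
    obtain ⟨l', h1, h2, h3⟩ := ih (v - g) (by omega) g (w :: l) (by omega)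
      (fun x hx => hpath x (by omega)) (fun x y hx => hM x y (by omega))
      ⟨hwadj.symm, fun x hx => ⟨(by have := hlt x hx; omega), hadj x hx g hwg hgv⟩, hl⟩
      (fun x hx => by
        rcases List.mem_cons.1 hx with rfl | hx
        · exact hwg
        · exact (hlt x hx).trans hwg)
      (fun x hx y h1 h2 => by
        rcases List.mem_cons.1 hx with rfl | hx
        · exact hmax y h1 h2
        · exact hadj x hx y (by omega) h2)
    refine ⟨l', h1, fun x hx => ?_, ?_⟩
    · rcases h2 x hx with h | h
      · rcases List.mem_cons.1 h with rfl | h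
        · exact Or.inr ⟨le_rfl, by omega⟩
        · exact Or.inl h
      · exact Or.inr ⟨by omega, h.2⟩
    · have := hM w g le_rfl hwg hgv hwadj
      rw [List.length_cons, Nat.mul_add] at h3
      omega

/-- On an interval whose consecutive vertices are adjacent and whose edges do not cross, there are
induced paths starting at either end, avoiding the other end, of logarithmic total length. -/
lemma exists_isInducedPath_pair {G : SimpleGraph ℕ} :
    ∀ (d u v : ℕ), v = u + d → 0 < d →
      (∀ x, u ≤ x → x < v → G.Adj x (x + 1)) →
      (∀ i j k l, u ≤ i → i < j → j < k → k < l → l ≤ v → G.Adj i k → ¬ G.Adj j l) →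
      ∃ l₁ l₂, IsInducedPath G (u :: l₁) ∧ IsInducedPath G (v :: l₂) ∧
        (∀ x ∈ l₁, u < x ∧ x < v) ∧ (∀ x ∈ l₂, u < x ∧ x < v) ∧
        d ≤ 2 ^ (l₁.length + l₂.length) := by
  intro d
  induction d using Nat.strong_induction_on with
  | _ d ih =>
    intro u v hv hd hpath hcross
    rcases Nat.lt_or_ge d 2 with hd2 | hd2
    · exact ⟨[], [], trivial, trivial, by simp, by simp, by simp; omega⟩
    -- `v` is excluded because it may be adjacent to `u`. The recursion keeps the larger of `[w, v]`
    -- and `[u, w]`: one path gains a vertex while the length at most halves.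
    obtain ⟨w, huw, hwv, huwadj, hmax⟩ :=
      exists_greatest_adj (v := v - 1) (by omega : u + 1 ≤ v - 1) (hpath u le_rfl (by omega))
    rcases Nat.lt_or_ge (2 * (w - u)) d with hlt | hge
    · obtain ⟨l₁, l₂, h1, h2, h3, h4, h5⟩ := ih (v - w) (by omega) w v (by omega) (by omega)
        (fun x hx => hpath x (by omega)) (fun i j k l hi => hcross i j k l (by omega))
      refine ⟨w :: l₁, l₂, ⟨huwadj, fun x hx => ?_, h1⟩, h2, fun x hx => ?_, fun x hx => ?_, ?_⟩
      · have := h3 x hx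
        exact ⟨by omega, fun h => hmax x this.1 (by omega) h.symm⟩
      · rcases List.mem_cons.1 hx with rfl | hx
        · omega
        · have := h3 x hx
          omega
      · have := h4 x hx
        omega
      · rw [List.length_cons, Nat.add_right_comm, pow_succ]
        omega
    · obtain ⟨l₁, l₂, h1, h2, h3, h4, h5⟩ := ih (w - u) (by omega) u w (by omega) (by omega)
        (fun x hx hx' => hpath x hx (by omega))
        (fun i j k l hi hij hjk hkl hl => hcross i j k l hi hij hjk hkl (by omega))
      -- The chord `uw` keeps vertices strictly between `u` and `w` from seeing beyond `w`. With `M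
      -- = v - w` the length bound just says that a vertex is gained.
      obtain ⟨l', h6, h7, h8⟩ := h2.exists_extend (v := v) (M := v - w) (v - w) w l₂ (by omega)
        (fun x hx => hpath x (by omega)) (fun x y _ _ _ _ => by omega)
        (fun x hx => (h4 x hx).2)
        (fun x hx y hy hyv => hcross u x w y le_rfl (h4 x hx).1 (h4 x hx).2 hy hyv huwadj)
      refine ⟨l₁, l', h1, h6, fun x hx => ?_, fun x hx => ?_, ?_⟩
      · have := h3 x hx
        omega
      · rcases h7 x hx with h | h
        · have := h4 x h
          omega
        · omega
      · have h9 : l₂.length + 1 ≤ l'.length := by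
          by_contra hcon
          have : (v - w) * l'.length ≤ (v - w) * l₂.length := Nat.mul_le_mul_left _ (by omega)
          omega
        have h10 : 2 ^ (l₁.length + l₂.length + 1) ≤ 2 ^ (l₁.length + l'.length) :=
          Nat.pow_le_pow_right (by norm_num) (by omega)
        rw [pow_succ] at h10
        omega

/-! ### Short and long chords, and the asymptotics -/

lemma IsPartialKTree.exists_isIndContained_pathGraph {V : Type u} {G : SimpleGraph V}
    (hG : IsPartialKTree 2 G) {n : ℕ} (hn : 0 < n) (hP : (pathGraph n).IsContained G) (M : ℕ) :
    ∃ m : ℕ, (pathGraph m).IsIndContained G ∧ (n + M ≤ M * m + 1 ∨ 4 * M ≤ 2 ^ (2 * m)) := by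
  obtain ⟨W, T, hT, ⟨f⟩⟩ := hG
  obtain ⟨p⟩ := hP
  let c : ℕ → V := fun i => if h : i < n then p ⟨i, h⟩ else p ⟨0, hn⟩
  have hcinj : Set.InjOn c {x | x < n} := by
    intro x hx y hy hxy
    simp only [Set.mem_ofPred_eq] at hx hy
    simp only [c, hx, hy, dif_pos] at hxy
    exact congrArg Fin.val (p.injective hxy)
  have hcadj : ∀ x, x + 1 < n → G.Adj (c x) (c (x + 1)) := by
    intro x hx
    have hx' : x < n := by omega
    simp only [c, hx, hx', dif_pos]
    exact p.toHom.map_adj (by simp [pathGraph_adj])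
  by_cases hlong : ∃ a b, a + M < b ∧ b < n ∧ G.Adj (c a) (c b)
  · obtain ⟨a, b, hab, hbn, hadj⟩ := hlong
    have hfinj : Set.InjOn (f ∘ c) (Set.Icc a b) :=
      f.injective.comp_injOn (hcinj.mono fun x hx => lt_of_le_of_lt hx.2 hbn)
    obtain ⟨l₁, l₂, h1, h2, h3, h4, h5⟩ := exists_isInducedPath_pair (G := G.comap c) (b - a) a b
      (by omega) (by omega) (fun x _ hx => hcadj x (by omega))
      (fun i j k l hi hij hjk hkl hl hik hjl =>
        hT.not_adj_of_crossing hfinj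
          (fun x _ hx => f.toHom.map_adj (hcadj x (by omega))) (f.toHom.map_adj hadj)
          hi hij hjk hkl hl (f.toHom.map_adj hik) (f.toHom.map_adj hjl))
    -- The factor `4` comes from counting the two end vertices `a` and `b`.
    have hpow : ∀ m, l₁.length + l₂.length + 2 ≤ 2 * m → 4 * M ≤ 2 ^ (2 * m) := by
      intro m hm
      have := Nat.pow_le_pow_right (n := 2) (by norm_num) hm
      rw [pow_add] at this
      omega
    rcases le_total l₁.length l₂.length with hle | hle
    · refine ⟨_, h2.isIndContained (hcinj.mono fun x hx => ?_), Or.inr (hpow _ ?_)⟩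
      · rcases List.mem_cons.1 hx with rfl | hx
        · exact hbn
        · exact (h4 x hx).2.trans hbn
      · rw [List.length_cons]
        omega
    · refine ⟨_, h1.isIndContained (hcinj.mono fun x hx => ?_), Or.inr (hpow _ ?_)⟩
      · rcases List.mem_cons.1 hx with rfl | hx
        · exact lt_trans (by omega) hbn
        · exact (h3 x hx).2.trans hbn
      · rw [List.length_cons]
        omega
  · push Not at hlong
    obtain ⟨l, h1, h2, h3⟩ := IsInducedPath.exists_extend (G := G.comap c) (v := n - 1) (M := M)
      (n - 1) 0 [] (by omega) (fun x _ hx => hcadj x (by omega))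
      (fun x y _ _ hy hadj => by
        by_contra hcon
        exact hlong x y (by omega) (by omega) hadj)
      trivial (by simp) (by simp)
    refine ⟨_, h1.isIndContained (hcinj.mono fun x hx => ?_), Or.inl ?_⟩
    · rcases List.mem_cons.1 hx with rfl | hx
      · exact Nat.sub_lt hn one_pos
      · rcases h2 x hx with h | h
        · simp at h
        · exact lt_of_lt_of_le h.2 (Nat.sub_le _ _)
    · rw [List.length_cons, Nat.mul_add]
      simp only [List.length_nil, Nat.mul_zero] at h3
      omega

lemma tendsto_logb_logb_div_logb :
    Filter.Tendsto (fun n : ℕ => Real.logb 2 (Real.logb 2 n) / (2 * Real.logb 2 n))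
      Filter.atTop (nhds 0) := by
  have h1 : Filter.Tendsto (fun n : ℕ => Real.logb 2 (n : ℝ)) Filter.atTop Filter.atTop :=
    (Real.tendsto_logb_atTop one_lt_two).comp tendsto_natCast_atTop_atTop
  have h2 : Filter.Tendsto (fun x : ℝ => Real.log x / x) Filter.atTop (nhds 0) :=
    Real.isLittleO_log_id_atTop.tendsto_div_nhds_zero
  have h3 := (h2.comp h1).mul_const (1 / (2 * Real.log 2))
  rw [zero_mul] at h3
  refine h3.congr fun n => ?_
  simp only [Function.comp_apply]
  rw [Real.logb.eq_1 2 (Real.logb 2 (n : ℝ)), div_mul_div_comm, div_div, mul_one]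
  congr 1
  ring

theorem corollary2p5 :
    ∃ ε : ℕ → ℝ, Filter.Tendsto ε Filter.atTop (nhds 0) ∧
      ∀ (n : ℕ) (V : Type u) (G : SimpleGraph V),
        IsPartialKTree 2 G → (SimpleGraph.pathGraph n).IsContained G →
          ∃ m : ℕ, (1 / 2 - ε n) * Real.logb 2 (n : ℝ) ≤ (m : ℝ) ∧
            (SimpleGraph.pathGraph m).IsIndContained G := by
  refine ⟨_, tendsto_logb_logb_div_logb, fun n V G hG hP => ?_⟩
  rcases Nat.lt_or_ge n 2 with hn | hn
  · refine ⟨0, ?_, ⟨⟨⟨fun i => i.elim0, fun i => i.elim0⟩, fun {i} => i.elim0⟩⟩⟩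
    have : Real.logb 2 (n : ℝ) = 0 := by interval_cases n <;> simp
    rw [this, mul_zero, Nat.cast_zero]
  have hn' : (2 : ℝ) ≤ n := by exact_mod_cast hn
  set L := Real.logb 2 (n : ℝ) with hL
  have hL1 : 1 ≤ L := by
    rw [hL, Real.le_logb_iff_rpow_le one_lt_two (by linarith)]
    simpa using hn'
  have hLn : L ≤ n := by
    rw [hL, Real.logb_le_iff_le_rpow one_lt_two (by linarith), Real.rpow_natCast]
    exact_mod_cast Nat.lt_two_pow_self.le
  have hLL : 0 ≤ Real.logb 2 L := Real.logb_nonneg one_lt_two hL1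
  have hε : (1 / 2 - Real.logb 2 L / (2 * L)) * L = (L - Real.logb 2 L) / 2 := by
    field_simp
  -- With `M = ⌈n / L⌉`, short chords give `m ≥ L / 2` since `M ≤ 2n / L`; a long chord gives `2m ≥
  -- log₂ (n / L) = L - log₂ L`, which dictates `ε`.
  obtain ⟨m, hm, hM⟩ :=
    hG.exists_isIndContained_pathGraph (by omega : 0 < n) hP ⌈(n : ℝ) / L⌉₊
  refine ⟨m, ?_, hm⟩
  rw [hε]
  have hM1 := Nat.le_ceil ((n : ℝ) / L)
  have hM2 := Nat.ceil_lt_add_one (show 0 ≤ (n : ℝ) / L by positivity)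
  set M := ⌈(n : ℝ) / L⌉₊
  have hdiv : 1 ≤ (n : ℝ) / L := by rw [le_div_iff₀ (by linarith)]; linarith
  rcases hM with hM | hM
  · have h1 : (n : ℝ) + M ≤ M * m + 1 := by exact_mod_cast hM
    have h2 : (n : ℝ) ≤ M * m := by linarith
    have h3 : (n : ℝ) ≤ (2 * (n / L)) * m :=
      h2.trans (mul_le_mul_of_nonneg_right (by linarith) (Nat.cast_nonneg m))
    have h4 : (n : ℝ) * L ≤ n * (2 * m) := by
      calc (n : ℝ) * L ≤ (2 * (n / L)) * m * L := mul_le_mul_of_nonneg_right h3 (by linarith)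
        _ = n * (2 * m) := by field_simp
    have h5 : L ≤ 2 * m := le_of_mul_le_mul_left h4 (by linarith)
    linarith
  · have h1 : (4 : ℝ) * M ≤ 2 ^ (2 * m) := by exact_mod_cast hM
    have h2 : (n : ℝ) / L ≤ 2 ^ (2 * m) := by linarith
    have h3 : Real.logb 2 ((n : ℝ) / L) ≤ (2 * m : ℕ) := by
      rw [Real.logb_le_iff_le_rpow one_lt_two (by linarith), Real.rpow_natCast]
      exact h2
    rw [Real.logb_div (by linarith) (by linarith)] at h3
    push_cast at h3
    linarith
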